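/- For $p\in[0,1]$ and an $\mathbb N_0$-valued random variable $X$, the $p$-thinning of $X$ is $p\odot X=\sum_{i=1}^{X}\varepsilon_i$, where the $\varepsilon_i$ are $\mathrm{Bin}(1,p)$-distributed and independent of each other and of $X$. When the components of a random vector $(X_1,\ldots,X_s)$ are thinned, $p_r\odot X_r=\sum_{i=1}^{X_r}\varepsilon_{r,i}$, all variables $\varepsilon_{r,i}\sim\mathrm{Bin}(1,p_r)$, $r=1,\ldots,s$, $i\in\mathbb N$, are independent of each other and the whole family is independent of the vector $(X_1,\ldots,X_s)$. Let $\mathbf Y=(Y_1,\ldots,Y_s)$ be a random vector with a.s. non-negative components and distribution $F_{\mathbf Y}$. A random vector $\mathbf Z=(Z_1,\ldots,Z_s)$ with values in $\mathbb N_0^s$ has the multivariate mixed Poisson distribution with mixing distribution of $\mathbf Y$ if, for all $k_1,\ldots,k_s\in\mathbb N_0$, $$\mathbb P\{Z_1=k_1,\ldots,Z_s=k_s\}=\int_{[0,+\infty)^s}\prod_{r=1}^s\frac{e^{-y_r}y_r^{k_r}}{k_r!}\,F_{\mathbf Y}(dy_1,\ldots,dy_s).$$ **Theorem.** Let $\mathbf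 X^{(n)}=(X_1^{(n)},\ldots,X_s^{(n)})$, $n\in\mathbb N$, be a sequence of random vectors with $\mathbb N_0$-valued components (for different $n$ they may be defined on different probability spaces), and let $(p_1^{(n)},\ldots,p_s^{(n)})\in[0,1]^s$, $n\in\mathbb N$, be a non-random sequence with $\lim_{n\to\infty}p_r^{(n)}=0$ for $r=1,\ldots,s$. Assume that $$\bigl(p_1^{(n)}\odot X_1^{(n)},\ldots,p_s^{(n)}\odot X_s^{(n)}\bigr)\xrightarrow{d}(Z_1,\ldots,Z_s)\quad\text{as }n\to\infty,$$ where $(Z_1,\ldots,Z_s)$ has the multivariate mixed Poisson distribution with mixing distribution of $\mathbf Y=(Y_1,\ldots,Y_s)$. Suppose additionally that $$\sup_{n\in\mathbb N}p_r^{(n)}\,\mathbb E X_r^{(n)}<\infty,\quad r=1,\ldots,s$$ (with the convention $0\cdot\infty=0$). Then $$\bigl(p_1^{(n)}X_1^{(n)},\ldots,p_s^{(n)}X_s^{(n)}\bigr)\xrightarrow{d}(Y_1,\ldots,Y_s)\quad\text{as }n\to\infty.$$ -/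

import Mathlib

open MeasureTheory ProbabilityTheory Filter
open scoped Topology unitInterval

noncomputable section

/-- The variables `ε r i` (`r < s`, `i ∈ ℕ`) can be used to thin the `ℕ`-valued random vector
`X = (X_1, …, X_s)` with retention probabilities `p = (p_1, …, p_s)`: each `ε r i` has the law
`Bin(1, p_r)`, all the `ε r i` are mutually independent, and the whole family is independent of
the random vector `X`. -/
structure IsThinningFamily {Ω : Type*} [MeasurableSpace Ω] {s : ℕ} (μ : Measure Ω)
    (p : Fin s → I) (X : Ω → Fin s → ℕ) (ε : Fin s → ℕ → Ω → ℕ) : Prop where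
  law : ∀ r i, HasLaw (ε r i) (ProbabilityTheory.binomial 1 (p r)) μ
  indep_family : iIndepFun (fun (j : Fin s × ℕ) ω => ε j.1 j.2 ω) μ
  indep_vector : IndepFun X (fun ω (j : Fin s × ℕ) => ε j.1 j.2 ω) μ

/-- The thinned vector `(p_1 ⊙ X_1, …, p_s ⊙ X_s)`, where `p_r ⊙ X_r` is the sum of the first
`X_r` of the variables `ε r 0, ε r 1, …`. -/
def thinned {Ω : Type*} {s : ℕ} (X : Ω → Fin s → ℕ) (ε : Fin s → ℕ → Ω → ℕ) :
    Ω → Fin s → ℕ :=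
  fun ω r => ∑ i ∈ Finset.range (X ω r), ε r i ω

/-- The `ℕ`-valued random vector `Z` has the multivariate mixed Poisson distribution with mixing
distribution `Q`, a probability law on `ℝ^s` (carried by `[0, ∞)^s`):
`P(Z_1 = k_1, …, Z_s = k_s) = ∫_{[0, ∞)^s} ∏_r e^{-y_r} y_r^{k_r} / k_r! Q(dy)`. -/
def IsMixedPoisson {Ω : Type*} [MeasurableSpace Ω] {s : ℕ} (ν : Measure Ω)
    (Z : Ω → Fin s → ℕ) (Q : Measure (Fin s → ℝ)) : Prop :=
  ∀ k : Fin s → ℕ, ν.real {ω | Z ω = k} =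
    ∫ y in {y : Fin s → ℝ | ∀ r, 0 ≤ y r},
      ∏ r, (Real.exp (-(y r)) * y r ^ k r / (Nat.factorial (k r) : ℝ)) ∂Q

end

/-! For `t` in `[0,1]^s`, evaluate generating functions at `z = 1 - t`. The thinned vector gives `E
∏ (1 - p_r t_r)^{X_r}`, and the mixed Poisson vector gives the Laplace transform of `Y` at `t`.
Since `(1 - u)^k` and `e^{-uk}` differ by at most `k u²` on `[0,1]`, the former is within `∑ p_r ·
p_r E X_r` of the Laplace transform of `(p_r X_r)`. This error vanishes because `p_r → 0` while `p_r
E X_r` stays bounded. Hence the Laplace transforms converge on the cube `[0,1]^s`.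

The moment bound also gives tightness, by Markov's inequality. Every limit point is carried by the
orthant and has the Laplace transform of `Y` on the cube, which determines it (`ext_of_laplace_eq`).
-/

lemma abs_prod_sub_prod_le {ι : Type*} (s : Finset ι) (a b : ι → ℝ)
    (ha : ∀ i ∈ s, a i ∈ Set.Icc 0 1) (hb : ∀ i ∈ s, b i ∈ Set.Icc 0 1) :
    |∏ i ∈ s, a i - ∏ i ∈ s, b i| ≤ ∑ i ∈ s, |a i - b i| := by
  classical
  induction s using Finset.induction_on with
  | empty => simp
  | insert i s hi ih =>
    rw [Finset.prod_insert hi, Finset.prod_insert hi, Finset.sum_insert hi]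
    have ih' := ih (fun j hj => ha j (Finset.mem_insert_of_mem hj))
      (fun j hj => hb j (Finset.mem_insert_of_mem hj))
    have hbi := hb i (Finset.mem_insert_self _ _)
    have hA : |∏ j ∈ s, a j| ≤ 1 := by
      rw [Finset.abs_prod]
      refine Finset.prod_le_one (fun _ _ => abs_nonneg _) fun j hj => ?_
      have := ha j (Finset.mem_insert_of_mem hj)
      rw [abs_of_nonneg this.1]
      exact this.2
    calc |a i * ∏ j ∈ s, a j - b i * ∏ j ∈ s, b j|
        = |(a i - b i) * ∏ j ∈ s, a j + b i * (∏ j ∈ s, a j - ∏ j ∈ s, b j)| := by ring_nf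
      _ ≤ |a i - b i| * |∏ j ∈ s, a j| + |b i| * |∏ j ∈ s, a j - ∏ j ∈ s, b j| := by
          rw [← abs_mul, ← abs_mul]
          exact abs_add_le _ _
      _ ≤ |a i - b i| * 1 + 1 * ∑ j ∈ s, |a j - b j| := by
          gcongr
          exact abs_le.2 ⟨by linarith [hbi.1], hbi.2⟩
      _ = _ := by ring

/-! ### Laplace transforms on the orthant: uniqueness and continuity -/

/-- Two random variables whose moment generating functions are finite and agree on `(-δ, δ)` have
the same complex moment generating function on the strip `|re z| < δ`. -/
lemma eqOn_complexMGF_of_mgf_eqOn {Ω Ω' : Type*} [MeasurableSpace Ω] [MeasurableSpace Ω']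
    {μ : Measure Ω} {ν : Measure Ω'} {X : Ω → ℝ} {Y : Ω' → ℝ} {δ : ℝ} (hδ : 0 < δ)
    (hX : Set.Ioo (-δ) δ ⊆ integrableExpSet X μ) (hY : Set.Ioo (-δ) δ ⊆ integrableExpSet Y ν)
    (h : Set.EqOn (mgf X μ) (mgf Y ν) (Set.Ioo (-δ) δ)) :
    Set.EqOn (complexMGF X μ) (complexMGF Y ν) {z | z.re ∈ Set.Ioo (-δ) δ} := by
  have hX' : AnalyticOnNhd ℂ (complexMGF X μ) {z | z.re ∈ Set.Ioo (-δ) δ} := fun z hz =>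
    analyticOnNhd_complexMGF z (interior_maximal hX isOpen_Ioo hz)
  have hY' : AnalyticOnNhd ℂ (complexMGF Y ν) {z | z.re ∈ Set.Ioo (-δ) δ} := fun z hz =>
    analyticOnNhd_complexMGF z (interior_maximal hY isOpen_Ioo hz)
  refine AnalyticOnNhd.eqOn_of_preconnected_of_frequently_eq hX' hY'
    (((convex_Ioo _ _).linear_preimage Complex.reLm).isPreconnected) (z₀ := 0) (by simp [hδ]) ?_
  have h_real : ∃ᶠ x : ℝ in 𝓝[≠] 0, complexMGF X μ x = complexMGF Y ν x := by
    refine Eventually.frequently ?_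
    filter_upwards [nhdsWithin_le_nhds (Ioo_mem_nhds (neg_lt_zero.2 hδ) hδ)] with x hx
    rw [complexMGF_ofReal, complexMGF_ofReal, h hx]
  rw [frequently_iff_seq_forall] at h_real ⊢
  obtain ⟨xs, hx_tendsto, hx_eq⟩ := h_real
  refine ⟨fun n ↦ xs n, ?_, fun n ↦ by simp [hx_eq]⟩
  rw [tendsto_nhdsWithin_iff] at hx_tendsto ⊢
  refine ⟨?_, by simpa using hx_tendsto.2⟩
  exact (Complex.continuous_ofReal.tendsto 0).comp hx_tendsto.1

lemma integrable_exp_neg_sum_of_nonneg {ι : Type*} [Fintype ι] {μ : Measure (ι → ℝ)}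
    [IsFiniteMeasure μ] (hμ : ∀ᵐ y ∂μ, ∀ r, 0 ≤ y r) {t : ι → ℝ} (ht : ∀ r, 0 ≤ t r) :
    Integrable (fun y => Real.exp (-∑ r, t r * y r)) μ := by
  refine Integrable.of_bound (Continuous.aestronglyMeasurable (by fun_prop)) 1 ?_
  filter_upwards [hμ] with y hy
  rw [Real.norm_eq_abs, Real.abs_exp, Real.exp_le_one_iff, neg_nonpos]
  exact Finset.sum_nonneg fun r _ => mul_nonneg (ht r) (hy r)

/-- A law on `[0, ∞)^ι` is determined by the values of its Laplace transform on `[0, 1]^ι`. -/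
theorem ext_of_laplace_eq {ι : Type*} [Fintype ι] {μ ν : Measure (ι → ℝ)}
    [IsProbabilityMeasure μ] [IsProbabilityMeasure ν]
    (hμ : ∀ᵐ y ∂μ, ∀ r, 0 ≤ y r) (hν : ∀ᵐ y ∂ν, ∀ r, 0 ≤ y r)
    (h : ∀ t : ι → ℝ, (∀ r, t r ∈ Set.Icc 0 1) →
      ∫ y, Real.exp (-∑ r, t r * y r) ∂μ = ∫ y, Real.exp (-∑ r, t r * y r) ∂ν) :
    μ = ν := by
  classical
  -- Tilting moves the centre `(1/2, …, 1/2)` of the cube to the origin: Laplace values on the cube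
  -- become moment generating functions on a neighbourhood of `0`.
  set f : (ι → ℝ) → ℝ := fun y => -∑ r, (1 / 2 : ℝ) * y r with hf
  have hfμ : Integrable (fun y => Real.exp (f y)) μ :=
    integrable_exp_neg_sum_of_nonneg hμ fun _ => by norm_num
  have hfν : Integrable (fun y => Real.exp (f y)) ν :=
    integrable_exp_neg_sum_of_nonneg hν fun _ => by norm_num
  have := isProbabilityMeasure_tilted hfμ
  have := isProbabilityMeasure_tilted hfν
  have hadd (a : ι → ℝ) (y : ι → ℝ) :
      f y + ∑ r, a r * y r = -∑ r, (1 / 2 - a r) * y r := by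
    simp only [hf, sub_mul, Finset.sum_sub_distrib]
    ring
  have hint (a : ι → ℝ) (ha : ∀ r, |a r| ≤ 1 / 2) (ρ : Measure (ι → ℝ)) [IsProbabilityMeasure ρ]
      (hρ : ∀ᵐ y ∂ρ, ∀ r, 0 ≤ y r) :
      Integrable (fun y => Real.exp (∑ r, a r * y r)) (ρ.tilted f) := by
    rw [integrable_tilted_iff]
    · simp_rw [smul_eq_mul, ← Real.exp_add, hadd]
      exact integrable_exp_neg_sum_of_nonneg hρ fun r => by linarith [(abs_le.1 (ha r)).2]
    · exact integrable_exp_neg_sum_of_nonneg hρ fun _ => by norm_num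
  have heq (a : ι → ℝ) (ha : ∀ r, |a r| ≤ 1 / 2) :
      ∫ y, Real.exp (∑ r, a r * y r) ∂(μ.tilted f) =
        ∫ y, Real.exp (∑ r, a r * y r) ∂(ν.tilted f) := by
    rw [integral_exp_tilted, integral_exp_tilted]
    simp_rw [Pi.add_apply, hadd]
    rw [h _ fun r => ⟨by linarith [(abs_le.1 (ha r)).2], by linarith [(abs_le.1 (ha r)).1]⟩,
      h _ fun r => ⟨by norm_num, by norm_num⟩]
  have htilt : μ.tilted f = ν.tilted f := by
    refine Measure.ext_of_charFunDual (funext fun L => ?_)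
    set a : ι → ℝ := fun r => L fun j => if r = j then 1 else 0
    have hL (y : ι → ℝ) : L y = ∑ r, a r * y r := by
      rw [← ContinuousLinearMap.coe_coe, LinearMap.pi_apply_eq_sum_univ]
      exact Finset.sum_congr rfl fun r _ => mul_comm _ _
    set c : ℝ := ∑ r, |a r|
    have hc : 0 ≤ c := Finset.sum_nonneg fun _ _ => abs_nonneg _
    -- Keeps every `θ * a r` in `[-1/2, 1/2]`; the `+ 1` covers `c = 0`.
    set δ : ℝ := 1 / (2 * (c + 1)) with hδ_def
    have hδ : 0 < δ := by positivity
    have hsmall (θ : ℝ) (hθ : θ ∈ Set.Ioo (-δ) δ) (r : ι) : |θ * a r| ≤ 1 / 2 := by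
      have h1 : |a r| ≤ c :=
        Finset.single_le_sum (f := fun r => |a r|) (fun _ _ => abs_nonneg _) (Finset.mem_univ r)
      rw [abs_mul]
      calc |θ| * |a r| ≤ δ * (c + 1) := by
            gcongr
            · exact (abs_lt.2 hθ).le
            · linarith
        _ = 1 / 2 := by rw [hδ_def]; field_simp
    have hexp (θ : ℝ) (y : ι → ℝ) : θ * L y = ∑ r, (θ * a r) * y r := by
      rw [hL, Finset.mul_sum]
      simp_rw [mul_assoc]
    have key := eqOn_complexMGF_of_mgf_eqOn (X := L) (Y := L) (μ := μ.tilted f) (ν := ν.tilted f)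
      hδ (fun θ hθ => by
        simpa only [integrableExpSet, Set.mem_ofPred_eq, hexp] using hint _ (hsmall θ hθ) μ hμ)
      (fun θ hθ => by
        simpa only [integrableExpSet, Set.mem_ofPred_eq, hexp] using hint _ (hsmall θ hθ) ν hν)
      (fun θ hθ => by simpa only [mgf, hexp] using heq _ (hsmall θ hθ))
    -- The point `i` lies in the strip and gives the characteristic functional at `L`.
    have := key (x := Complex.I) (by simp [hδ])
    simpa only [complexMGF, charFunDual_apply, mul_comm Complex.I] using this
  rw [← tilted_neg_same hfμ, htilt, tilted_neg_same hfν]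

/-- **Continuity theorem for Laplace transforms**: a tight sequence of laws on `[0, ∞)^ι` whose
Laplace transforms converge on `[0, 1]^ι` to the one of a law on `[0, ∞)^ι` converges weakly. -/
theorem tendsto_of_tight_of_tendsto_laplace {ι : Type*} [Fintype ι]
    {P : ℕ → ProbabilityMeasure (ι → ℝ)} {P₀ : ProbabilityMeasure (ι → ℝ)}
    (htight : IsTightMeasureSet {(P n : Measure (ι → ℝ)) | n})
    (hP : ∀ n, ∀ᵐ y ∂(P n : Measure (ι → ℝ)), ∀ r, 0 ≤ y r)
    (hP₀ : ∀ᵐ y ∂(P₀ : Measure (ι → ℝ)), ∀ r, 0 ≤ y r)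
    (h : ∀ t : ι → ℝ, (∀ r, t r ∈ Set.Icc 0 1) →
      Tendsto (fun n => ∫ y, Real.exp (-∑ r, t r * y r) ∂(P n : Measure (ι → ℝ))) atTop
        (𝓝 (∫ y, Real.exp (-∑ r, t r * y r) ∂(P₀ : Measure (ι → ℝ))))) :
    Tendsto P atTop (𝓝 P₀) := by
  -- By Prokhorov the laws converge along each ultrafilter, so only the limit has to be identified.
  refine (Filter.tendsto_iff_ultrafilter _ _ _).2 fun U hU ↦ ?_
  have h_compact : IsCompact (closure {P n | n}) :=
    isCompact_closure_of_isTightMeasureSet (by simpa using htight)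
  obtain ⟨ρ, -, hρ : Tendsto _ _ _⟩ := h_compact.ultrafilter_le_nhds (U.map P)
    (.trans (by simp) (monotone_principal subset_closure))
  change Tendsto P U (𝓝 ρ) at hρ
  suffices (ρ : Measure (ι → ℝ)) = P₀ by
    rwa [Subtype.ext this] at hρ
  have hρ0 : ∀ᵐ y ∂(ρ : Measure (ι → ℝ)), ∀ r, 0 ≤ y r := by
    have hopen : IsOpen {y : ι → ℝ | ¬ ∀ r, 0 ≤ y r} := by
      have : IsClosed {y : ι → ℝ | ∀ r, 0 ≤ y r} := by
        simp only [Set.ofPred_forall]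
        exact isClosed_iInter fun r => isClosed_le continuous_const (continuous_apply r)
      exact this.isOpen_compl
    have := ProbabilityMeasure.le_liminf_measure_open_of_tendsto hρ hopen
    have hz : ∀ n, (P n : Measure (ι → ℝ)) {y : ι → ℝ | ¬ ∀ r, 0 ≤ y r} = 0 := fun n => hP n
    simp only [hz, liminf_const] at this
    exact le_antisymm this bot_le
  refine ext_of_laplace_eq hρ0 hP₀ fun t ht => ?_
  refine tendsto_nhds_unique ?_ ((h t ht).comp hU)
  -- The exponential is unbounded off the orthant; truncating at `0` gives a bounded test function
  -- that agrees with it almost everywhere.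
  let g : BoundedContinuousFunction (ι → ℝ) ℝ := BoundedContinuousFunction.ofNormedAddCommGroup
    (fun y => Real.exp (-∑ r, t r * max (y r) 0)) (by fun_prop) 1 fun y => by
      rw [Real.norm_eq_abs, Real.abs_exp, Real.exp_le_one_iff, neg_nonpos]
      exact Finset.sum_nonneg fun r _ => mul_nonneg (ht r).1 (le_max_right _ _)
  have hg (Q : ProbabilityMeasure (ι → ℝ)) (hQ : ∀ᵐ y ∂(Q : Measure (ι → ℝ)), ∀ r, 0 ≤ y r) :
      ∫ y, g y ∂(Q : Measure (ι → ℝ)) = ∫ y, Real.exp (-∑ r, t r * y r) ∂(Q : Measure (ι → ℝ)) := by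
    refine integral_congr_ae ?_
    filter_upwards [hQ] with y hy
    simp [g, max_eq_left (hy _)]
  have := ProbabilityMeasure.tendsto_iff_forall_integral_tendsto.1 hρ g
  rw [hg ρ hρ0] at this
  refine this.congr fun n => ?_
  rw [hg (P n) (hP n)]
  rfl

/-- Laws of bounded first moment form a tight set. -/
lemma isTightMeasureSet_of_lintegral_enorm_le {E : Type*} [NormedAddCommGroup E] [ProperSpace E]
    [MeasurableSpace E] [OpensMeasurableSpace E] {S : Set (Measure E)} {C : ENNReal} (hC : C ≠ ⊤)
    (hS : ∀ μ ∈ S, ∫⁻ x, ‖x‖ₑ ∂μ ≤ C) : IsTightMeasureSet S := by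
  refine isTightMeasureSet_of_tendsto_measure_norm_gt ?_
  have hlim : Tendsto (fun r : ℝ => C / ENNReal.ofReal r) atTop (𝓝 0) := by
    have := ENNReal.Tendsto.const_div (a := C) ENNReal.tendsto_ofReal_atTop (Or.inr hC)
    simpa using this
  refine tendsto_of_tendsto_of_tendsto_of_le_of_le' tendsto_const_nhds hlim
    (Eventually.of_forall fun _ => bot_le) ?_
  filter_upwards [eventually_gt_atTop 0] with r hr
  refine iSup₂_le fun μ hμ => ?_
  calc μ {x | r < ‖x‖} ≤ μ {x | ENNReal.ofReal r ≤ ‖x‖ₑ} := by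
        refine measure_mono fun x hx => ?_
        rw [Set.mem_ofPred_eq, ← ofReal_norm]
        exact ENNReal.ofReal_le_ofReal (le_of_lt hx)
    _ ≤ (∫⁻ x, ‖x‖ₑ ∂μ) / ENNReal.ofReal r :=
        meas_ge_le_lintegral_div (by fun_prop) (by simpa using hr) ENNReal.ofReal_ne_top
    _ ≤ C / ENNReal.ofReal r := by gcongr; exact hS μ hμ

/-! ### Generating functions of thinned and mixed Poisson vectors -/

lemma integral_pow_binomial_one (p : I) (z : ℝ) :
    ∫ k, z ^ k ∂(binomial 1 p) = 1 - p * (1 - z) := by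
  have hae : ∀ᵐ k ∂(binomial 1 p), k ∈ ({0, 1} : Set ℕ) := by
    filter_upwards [ae_le_of_hasLaw_binomial (HasLaw.id (μ := binomial 1 p))] with k hk
    simp only [id] at hk
    simp only [Set.mem_insert_iff, Set.mem_singleton_iff]
    omega
  rw [← Measure.restrict_eq_self_of_ae_mem hae, ← Finset.coe_pair,
    setIntegral_finset _ (Integrable.of_bound (measurable_of_countable _).aestronglyMeasurable
      (max 1 |z|) ?_)]
  · simp
    ring
  · refine (ae_restrict_iff' (Finset.measurableSet _)).2 (Eventually.of_forall fun k hk => ?_)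
    rcases (by simpa using hk : k = 0 ∨ k = 1) with rfl | rfl <;> simp

lemma hasSum_poisson_mul_pow (y z : ℝ) :
    HasSum (fun k : ℕ => Real.exp (-y) * y ^ k / (k.factorial : ℝ) * z ^ k)
      (Real.exp (-((1 - z) * y))) := by
  have := (NormedSpace.expSeries_div_hasSum_exp (y * z)).mul_left (Real.exp (-y))
  rw [← Real.exp_eq_exp_ℝ, ← Real.exp_add] at this
  convert! this using 1
  · ext k
    rw [mul_pow]
    ring
  · ring_nf

/-- The number of summands varies with `x.1`, but that coordinate is countable, so it may be frozen.
-/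
lemma measurable_prod_pow {s : ℕ} (z : Fin s → ℝ) :
    Measurable fun x : (Fin s → ℕ) × (Fin s × ℕ → ℕ) =>
      ∏ r, z r ^ (∑ i ∈ Finset.range (x.1 r), x.2 (r, i)) := by
  refine measurable_from_prod_countable_right fun k => ?_
  refine Finset.measurable_prod _ fun r _ => ?_
  have h : Measurable fun e : Fin s × ℕ → ℕ => ∑ i ∈ Finset.range (k r), e (r, i) :=
    Finset.measurable_sum _ fun i _ => measurable_pi_apply _
  exact (measurable_of_countable fun n : ℕ => z r ^ n).comp h

lemma abs_prod_pow_le_one {ι : Type*} (s : Finset ι) {z : ι → ℝ} (hz : ∀ r, z r ∈ Set.Icc 0 1)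
    (k : ι → ℕ) : |∏ r ∈ s, z r ^ k r| ≤ 1 := by
  rw [abs_of_nonneg (Finset.prod_nonneg fun r _ => pow_nonneg (hz r).1 _)]
  exact Finset.prod_le_one (fun r _ => pow_nonneg (hz r).1 _) fun r _ =>
    pow_le_one₀ (hz r).1 (hz r).2

section Thinning

variable {Ω : Type*} [MeasurableSpace Ω] {s : ℕ} {μ : Measure Ω}
  {p : Fin s → I} {X : Ω → Fin s → ℕ} {ε : Fin s → ℕ → Ω → ℕ}

lemma IsThinningFamily.integral_prod_pow_sum (hε : IsThinningFamily μ p X ε) (z : Fin s → ℝ)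
    (k : Fin s → ℕ) :
    ∫ ω, ∏ r, z r ^ (∑ i ∈ Finset.range (k r), ε r i ω) ∂μ =
      ∏ r, (1 - p r * (1 - z r)) ^ k r := by
  -- Indexes the finitely many thinning variables in use, so that independence factors the integral.
  let g : (Σ r : Fin s, Fin (k r)) → Fin s × ℕ := fun j => (j.1, j.2)
  have hg : Function.Injective g := by
    rintro ⟨r, i⟩ ⟨r', i'⟩ h
    simp only [g, Prod.mk.injEq] at h
    obtain ⟨rfl, h⟩ := h
    rw [Fin.ext h]
  have hind := hε.indep_family.precomp hg
  have := hind.integral_fun_prod_comp (f := fun j (n : ℕ) => z j.1 ^ n)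
    (fun j => (hε.law _ _).aemeasurable)
    (fun j => (measurable_of_countable _).aestronglyMeasurable)
  simp only [Fintype.prod_sigma, g] at this
  have hlaw (r : Fin s) (i : ℕ) : ∫ ω, z r ^ ε r i ω ∂μ = 1 - p r * (1 - z r) := by
    rw [← integral_pow_binomial_one, ← (hε.law r i).map_eq, integral_map (hε.law r i).aemeasurable
      (measurable_of_countable _).aestronglyMeasurable]
  simp only [hlaw, Finset.prod_const, Finset.card_univ, Fintype.card_fin] at this
  rw [← this]
  congr 1 with ω
  refine Finset.prod_congr rfl fun r _ => ?_
  rw [Finset.prod_pow_eq_pow_sum, Finset.sum_range]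

/-- The probability generating function of a thinned vector. -/
theorem IsThinningFamily.integral_prod_pow_thinned [IsProbabilityMeasure μ]
    (hε : IsThinningFamily μ p X ε)
    (hX : AEMeasurable X μ) {z : Fin s → ℝ} (hz : ∀ r, z r ∈ Set.Icc 0 1) :
    ∫ ω, ∏ r, z r ^ thinned X ε ω r ∂μ = ∫ ω, ∏ r, (1 - p r * (1 - z r)) ^ X ω r ∂μ := by
  set E : Ω → Fin s × ℕ → ℕ := fun ω j => ε j.1 j.2 ω
  have hE : AEMeasurable E μ := aemeasurable_pi_lambda _ fun j => (hε.law j.1 j.2).aemeasurable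
  set G : (Fin s → ℕ) × (Fin s × ℕ → ℕ) → ℝ := fun x =>
    ∏ r, z r ^ (∑ i ∈ Finset.range (x.1 r), x.2 (r, i))
  have hG : Measurable G := measurable_prod_pow z
  have hprod := (indepFun_iff_map_prod_eq_prod_map_map hX hE).1 hε.indep_vector
  have := Measure.isProbabilityMeasure_map hX
  have := Measure.isProbabilityMeasure_map hE
  calc ∫ ω, ∏ r, z r ^ thinned X ε ω r ∂μ
      = ∫ x, G x ∂(μ.map fun ω => (X ω, E ω)) := by
        rw [integral_map (hX.prodMk hE) hG.aestronglyMeasurable]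
        rfl
    _ = ∫ k, ∫ e, G (k, e) ∂(μ.map E) ∂(μ.map X) := by
        rw [hprod, integral_prod]
        refine Integrable.of_bound hG.aestronglyMeasurable 1 (Eventually.of_forall fun x => ?_)
        exact abs_prod_pow_le_one _ hz _
    _ = ∫ k, ∏ r, (1 - p r * (1 - z r)) ^ k r ∂(μ.map X) := by
        congr 1 with k
        rw [integral_map (f := fun e => G (k, e)) hE
          (hG.comp measurable_prodMk_left).aestronglyMeasurable]
        exact hε.integral_prod_pow_sum z k
    _ = _ := by
        rw [integral_map hX (measurable_of_countable _).aestronglyMeasurable]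

end Thinning

/-- Counting measure on `ℕ^s` is the product of counting measures, so Fubini factors the multiple
series. -/
lemma hasSum_prod_poisson_mul_pow {s : ℕ} (y z : Fin s → ℝ) :
    HasSum (fun k : Fin s → ℕ => ∏ r, (Real.exp (-(y r)) * y r ^ k r /
      ((k r).factorial : ℝ) * z r ^ k r)) (Real.exp (-∑ r, (1 - z r) * y r)) := by
  set a : Fin s → ℕ → ℝ := fun r k => Real.exp (-(y r)) * y r ^ k / (k.factorial : ℝ) * z r ^ k
  have ha (r : Fin s) : HasSum (a r) (Real.exp (-((1 - z r) * y r))) := hasSum_poisson_mul_pow _ _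
  have hint : Integrable (fun k : Fin s → ℕ => ∏ r, a r (k r))
      (Measure.pi fun _ => Measure.count) :=
    Integrable.fintype_prod fun r => integrable_count_iff.2 (ha r).summable.norm
  have hpi : (Measure.pi fun _ : Fin s => (Measure.count : Measure ℕ)) = Measure.count := by
    refine Measure.ext_of_singleton fun k => ?_
    rw [← Set.univ_pi_singleton, Measure.pi_pi, Set.univ_pi_singleton]
    simp
  have h := integral_fintype_prod_eq_prod (μ := fun _ : Fin s => (Measure.count : Measure ℕ)) a
  rw [hpi] at hint h
  have hs := integrable_count_iff.1 hint
  have := hs.of_norm.hasSum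
  rw [integral_countable hint] at h
  have hc (r : Fin s) : ∫ k, a r k ∂Measure.count = Real.exp (-((1 - z r) * y r)) := by
    rw [integral_countable (integrable_count_iff.2 (ha r).summable.norm)]
    simpa using (ha r).tsum_eq
  simp only [hc, ← Real.exp_sum, Finset.sum_neg_distrib] at h
  rw [← h]
  simpa using this

/-- The probability generating function of a multivariate mixed Poisson vector is the Laplace
transform of the mixing distribution at `1 - z`. -/
theorem IsMixedPoisson.integral_prod_pow {Ω : Type*} [MeasurableSpace Ω] {s : ℕ} {ν : Measure Ω}
    [IsProbabilityMeasure ν] {Z : Ω → Fin s → ℕ} (hZm : AEMeasurable Z ν)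
    {Q : Measure (Fin s → ℝ)} [IsProbabilityMeasure Q] (hZ : IsMixedPoisson ν Z Q)
    (hQ : ∀ᵐ y ∂Q, ∀ r, 0 ≤ y r) {z : Fin s → ℝ} (hz : ∀ r, z r ∈ Set.Icc 0 1) :
    ∫ ω, ∏ r, z r ^ Z ω r ∂ν = ∫ y, Real.exp (-∑ r, (1 - z r) * y r) ∂Q := by
  have := Measure.isProbabilityMeasure_map hZm
  have hQr : Q.restrict {y | ∀ r, 0 ≤ y r} = Q := Measure.restrict_eq_self_of_ae_mem hQ
  set F : (Fin s → ℕ) → (Fin s → ℝ) → ℝ := fun k y =>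
    ∏ r, (Real.exp (-(y r)) * y r ^ k r / ((k r).factorial : ℝ) * z r ^ k r)
  have hF0 (k) (y : Fin s → ℝ) (hy : ∀ r, 0 ≤ y r) : 0 ≤ F k y :=
    Finset.prod_nonneg fun r _ => mul_nonneg (div_nonneg (mul_nonneg (Real.exp_nonneg _)
      (pow_nonneg (hy r) _)) (Nat.cast_nonneg _)) (pow_nonneg (hz r).1 _)
  have hFs (y : Fin s → ℝ) :
      HasSum (fun k => F k y) (Real.exp (-∑ r, (1 - z r) * y r)) :=
    hasSum_prod_poisson_mul_pow y z
  have hFm (k) : AEStronglyMeasurable (F k) Q :=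
    Continuous.aestronglyMeasurable (by fun_prop)
  have hLi := integrable_exp_neg_sum_of_nonneg hQ (t := fun r => 1 - z r)
    fun r => by linarith [(hz r).2]
  have hsum : HasSum (fun k => ∫ y, F k y ∂Q) (∫ y, Real.exp (-∑ r, (1 - z r) * y r) ∂Q) := by
    -- The terms are nonnegative almost everywhere, hence dominate themselves.
    refine hasSum_integral_of_dominated_convergence F hFm (fun k => ?_) ?_ ?_ ?_
    · filter_upwards [hQ] with y hy
      rw [Real.norm_of_nonneg (hF0 k y hy)]
    · exact Eventually.of_forall fun y => (hFs y).summable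
    · exact hLi.congr <| Eventually.of_forall fun y => (hFs y).tsum_eq.symm
    · exact Eventually.of_forall hFs
  have hpk (k : Fin s → ℕ) : (ν.map Z).real {k} * ∏ r, z r ^ k r = ∫ y, F k y ∂Q := by
    rw [map_measureReal_apply_of_aemeasurable hZm (measurableSet_singleton k)]
    have := hZ k
    rw [hQr] at this
    change ν.real {ω | Z ω = k} * _ = _
    rw [this, ← integral_mul_const]
    simp_rw [F, Finset.prod_mul_distrib]
  rw [← integral_map (f := fun k : Fin s → ℕ => ∏ r, z r ^ k r) hZm
    (measurable_of_countable _).aestronglyMeasurable, integral_countable]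
  · simp_rw [smul_eq_mul, hpk]
    exact hsum.tsum_eq
  · exact Integrable.of_bound (measurable_of_countable _).aestronglyMeasurable 1
      (Eventually.of_forall fun k => abs_prod_pow_le_one _ hz _)

/-! ### Comparing thinning with scaling -/

/-- Each of the `k` factors `1 - u` is exchanged for `e^{-u}` at cost at most `u²`. -/
lemma abs_one_sub_pow_sub_exp_le {u : ℝ} (hu : u ∈ Set.Icc 0 1) (k : ℕ) :
    |(1 - u) ^ k - Real.exp (-(u * k))| ≤ k * u ^ 2 := by
  have h1 : Real.exp (-(u * k)) = Real.exp (-u) ^ k := by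
    rw [← Real.exp_nat_mul]
    congr 1
    ring
  have h2 := abs_prod_sub_prod_le (Finset.range k) (fun _ => 1 - u) (fun _ => Real.exp (-u))
    (fun _ _ => ⟨by linarith [hu.2], by linarith [hu.1]⟩)
    (fun _ _ => ⟨Real.exp_nonneg _, Real.exp_le_one_iff.2 (by linarith [hu.1])⟩)
  simp only [Finset.prod_const, Finset.card_range, Finset.sum_const, nsmul_eq_mul] at h2
  rw [h1]
  refine h2.trans ?_
  gcongr
  have h3 := Real.norm_exp_sub_one_sub_id_le (x := -u)
    (by rw [norm_neg, Real.norm_of_nonneg hu.1]; exact hu.2)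
  rw [norm_neg, Real.norm_of_nonneg hu.1, Real.norm_eq_abs] at h3
  rwa [abs_sub_comm, show Real.exp (-u) - (1 - u) = Real.exp (-u) - 1 - -u by ring]

/-- The Laplace transform of `p X` is close to the generating function of the thinning of `X`. -/
lemma abs_prod_one_sub_pow_sub_exp_le {ι : Type*} [Fintype ι] {p t : ι → ℝ}
    (hp : ∀ r, p r ∈ Set.Icc 0 1) (ht : ∀ r, t r ∈ Set.Icc 0 1) (k : ι → ℕ) :
    |∏ r, (1 - p r * t r) ^ k r - Real.exp (-∑ r, t r * (p r * k r))| ≤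
      ∑ r, p r * (p r * k r) := by
  have hu (r : ι) : p r * t r ∈ Set.Icc (0 : ℝ) 1 :=
    ⟨mul_nonneg (hp r).1 (ht r).1, mul_le_one₀ (hp r).2 (ht r).1 (ht r).2⟩
  rw [← Finset.sum_neg_distrib, Real.exp_sum]
  refine (abs_prod_sub_prod_le _ _ _ (fun r _ => ?_) fun r _ => ?_).trans
    (Finset.sum_le_sum fun r _ => ?_)
  · have h0 : 0 ≤ 1 - p r * t r := by linarith [(hu r).2]
    exact ⟨pow_nonneg h0 _, pow_le_one₀ h0 (by linarith [(hu r).1])⟩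
  · refine ⟨Real.exp_nonneg _, Real.exp_le_one_iff.2 (neg_nonpos.2 ?_)⟩
    have := (hp r).1
    have := (ht r).1
    positivity
  · have h := abs_one_sub_pow_sub_exp_le (hu r) (k r)
    rw [show t r * (p r * k r) = p r * t r * k r by ring]
    refine h.trans ?_
    have h1 : p r * t r ≤ p r := mul_le_of_le_one_right (hp r).1 (ht r).2
    calc (k r : ℝ) * (p r * t r) ^ 2 ≤ k r * p r ^ 2 := by
          gcongr
          exact (hu r).1
      _ = p r * (p r * k r) := by ring

lemma enorm_pi_le_sum {ι : Type*} [Fintype ι] (x : ι → ℝ) : ‖x‖ₑ ≤ ∑ r, ‖x r‖ₑ := by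
  simp_rw [← ofReal_norm]
  rw [← ENNReal.ofReal_sum_of_nonneg fun _ _ => norm_nonneg _]
  refine ENNReal.ofReal_le_ofReal ((pi_norm_le_iff_of_nonneg
    (Finset.sum_nonneg fun _ _ => norm_nonneg _)).2 fun r => ?_)
  exact Finset.single_le_sum (f := fun r => ‖x r‖) (fun _ _ => norm_nonneg _) (Finset.mem_univ r)

/-! ### The limit theorem -/

theorem theorem5 {s : ℕ}
    {Ω : ℕ → Type*} [∀ n, MeasurableSpace (Ω n)]
    (μ : ∀ n, Measure (Ω n)) [∀ n, IsProbabilityMeasure (μ n)]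
    {Ω' : Type*} [MeasurableSpace Ω'] (μ' : Measure Ω') [IsProbabilityMeasure μ']
    {Ω'' : Type*} [MeasurableSpace Ω''] (μ'' : Measure Ω'') [IsProbabilityMeasure μ'']
    (X : ∀ n, Ω n → Fin s → ℕ) (hX : ∀ n, AEMeasurable (X n) (μ n))
    (p : ℕ → Fin s → I) (hp : ∀ r, Tendsto (fun n => (p n r : ℝ)) atTop (𝓝 0))
    (ε : ∀ n, Fin s → ℕ → Ω n → ℕ) (hε : ∀ n, IsThinningFamily (μ n) (p n) (X n) (ε n))
    (Y : Ω' → Fin s → ℝ) (hY : AEMeasurable Y μ') (hY0 : ∀ᵐ ω ∂μ', ∀ r, 0 ≤ Y ω r)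
    (Z : Ω'' → Fin s → ℕ) (hZ : IsMixedPoisson μ'' Z (μ'.map Y))
    (hconv : TendstoInDistribution (fun n => thinned (X n) (ε n)) atTop Z μ μ'')
    (hE : ∀ r, (⨆ n, ENNReal.ofReal (p n r) * ∫⁻ ω, (X n ω r : ENNReal) ∂(μ n)) < ⊤) :
    TendstoInDistribution (fun n ω r => (p n r : ℝ) * (X n ω r : ℝ)) atTop Y μ μ' := by
  have hcomp {n : ℕ} {β : Type} [MeasurableSpace β] (f : (Fin s → ℕ) → β) :
      AEMeasurable (fun ω => f (X n ω)) (μ n) :=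
    (measurable_of_countable f).comp_aemeasurable (hX n)
  have hV (n : ℕ) : AEMeasurable (fun ω r => (p n r : ℝ) * (X n ω r : ℝ)) (μ n) :=
    hcomp fun k r => (p n r : ℝ) * (k r : ℝ)
  have := Measure.isProbabilityMeasure_map hY
  have hnonneg : MeasurableSet {y : Fin s → ℝ | ∀ r, 0 ≤ y r} := by measurability
  have hQ : ∀ᵐ y ∂(μ'.map Y), ∀ r, 0 ≤ y r := (ae_map_iff hY hnonneg).2 hY0
  set C : Fin s → ENNReal :=
    fun r => ⨆ n, ENNReal.ofReal (p n r) * ∫⁻ ω, (X n ω r : ENNReal) ∂(μ n)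
  -- Bounding `p_r X_r` rather than `X_r` allows `p_r = 0` with `E X_r = ∞`.
  have hEn (n : ℕ) (r : Fin s) :
      ∫⁻ ω, ENNReal.ofReal ((p n r : ℝ) * X n ω r) ∂(μ n) ≤ C r := by
    simp_rw [ENNReal.ofReal_mul (p n r).2.1, ENNReal.ofReal_natCast]
    rw [lintegral_const_mul'' _ (hcomp fun k => (k r : ENNReal))]
    exact le_iSup (fun n => ENNReal.ofReal (p n r) * ∫⁻ ω, (X n ω r : ENNReal) ∂(μ n)) n
  refine ⟨hV, hY, tendsto_of_tight_of_tendsto_laplace ?_ (fun n => ?_) hQ fun t ht => ?_⟩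
  · refine isTightMeasureSet_of_lintegral_enorm_le (C := ∑ r, C r)
      (ENNReal.sum_ne_top.2 fun r _ => (hE r).ne) ?_
    rintro _ ⟨n, rfl⟩
    change ∫⁻ x, ‖x‖ₑ ∂((μ n).map _) ≤ _
    rw [lintegral_map' (by fun_prop) (hV n)]
    calc ∫⁻ ω, ‖fun r => (p n r : ℝ) * (X n ω r : ℝ)‖ₑ ∂(μ n)
        ≤ ∫⁻ ω, ∑ r, ENNReal.ofReal ((p n r : ℝ) * X n ω r) ∂(μ n) := by
          refine lintegral_mono fun ω => (enorm_pi_le_sum _).trans_eq ?_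
          refine Finset.sum_congr rfl fun r _ => ?_
          rw [Real.enorm_of_nonneg (mul_nonneg (p n r).2.1 (Nat.cast_nonneg _))]
      _ = ∑ r, ∫⁻ ω, ENNReal.ofReal ((p n r : ℝ) * X n ω r) ∂(μ n) :=
          lintegral_finsetSum' _ fun r _ => hcomp fun k => ENNReal.ofReal ((p n r : ℝ) * k r)
      _ ≤ ∑ r, C r := Finset.sum_le_sum fun r _ => hEn n r
  · exact (ae_map_iff (hV n) hnonneg).2 <| Eventually.of_forall fun ω r =>
      mul_nonneg (p n r).2.1 (Nat.cast_nonneg _)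
  · have hz (r : Fin s) : 1 - t r ∈ Set.Icc (0 : ℝ) 1 :=
      ⟨by linarith [(ht r).2], by linarith [(ht r).1]⟩
    have hgen : Tendsto (fun n => ∫ ω, ∏ r, (1 - (p n r : ℝ) * t r) ^ X n ω r ∂(μ n)) atTop
        (𝓝 (∫ y, Real.exp (-∑ r, t r * y r) ∂(μ'.map Y))) := by
      let g : BoundedContinuousFunction (Fin s → ℕ) ℝ :=
        BoundedContinuousFunction.ofNormedAddCommGroup (fun k => ∏ r, (1 - t r) ^ k r)
          (by fun_prop) 1 fun k => abs_prod_pow_le_one _ hz _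
      have h := ProbabilityMeasure.tendsto_iff_forall_integral_tendsto.1 hconv.tendsto g
      have hlim := hZ.integral_prod_pow hconv.aemeasurable_limit hQ hz
      simp only [sub_sub_cancel] at hlim
      rw [← hlim]
      convert! h using 2
      · rename_i n
        have hthin := (hε n).integral_prod_pow_thinned (hX n) hz
        simp only [sub_sub_cancel] at hthin
        rw [← hthin]
        exact (integral_map (f := fun k : Fin s → ℕ => ∏ r, (1 - t r) ^ k r)
          (hconv.forall_aemeasurable n)
          (measurable_of_countable _).aestronglyMeasurable).symm
      · exact (integral_map (f := fun k : Fin s → ℕ => ∏ r, (1 - t r) ^ k r)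
          hconv.aemeasurable_limit (measurable_of_countable _).aestronglyMeasurable).symm
    have hmap (n : ℕ) : ∫ y, Real.exp (-∑ r, t r * y r)
          ∂((μ n).map fun ω r => (p n r : ℝ) * (X n ω r : ℝ)) =
        ∫ ω, Real.exp (-∑ r, t r * ((p n r : ℝ) * X n ω r)) ∂(μ n) :=
      integral_map (hV n) (Continuous.aestronglyMeasurable (by fun_prop))
    have hgint (n : ℕ) : Integrable (fun ω => ∏ r, (1 - (p n r : ℝ) * t r) ^ X n ω r) (μ n) := by
      refine Integrable.of_bound (hcomp fun k => ∏ r, (1 - (p n r : ℝ) * t r) ^ k r).aestronglyMeasurable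
        1 (Eventually.of_forall fun ω => abs_prod_pow_le_one _ (fun r => ?_) _)
      have h1 := mul_nonneg (p n r).2.1 (ht r).1
      have h2 := mul_le_one₀ (p n r).2.2 (ht r).1 (ht r).2
      exact ⟨by linarith, by linarith⟩
    have heint (n : ℕ) :
        Integrable (fun ω => Real.exp (-∑ r, t r * ((p n r : ℝ) * X n ω r))) (μ n) := by
      refine Integrable.of_bound
        (hcomp fun k => Real.exp (-∑ r, t r * ((p n r : ℝ) * k r))).aestronglyMeasurable
        1 (Eventually.of_forall fun ω => ?_)
      rw [Real.norm_eq_abs, Real.abs_exp, Real.exp_le_one_iff, neg_nonpos]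
      exact Finset.sum_nonneg fun r _ =>
        mul_nonneg (ht r).1 (mul_nonneg (p n r).2.1 (Nat.cast_nonneg _))
    have hdist (n : ℕ) : edist (∫ ω, ∏ r, (1 - (p n r : ℝ) * t r) ^ X n ω r ∂(μ n))
        (∫ ω, Real.exp (-∑ r, t r * ((p n r : ℝ) * X n ω r)) ∂(μ n)) ≤
        ∑ r, ENNReal.ofReal (p n r) * C r := by
      rw [edist_eq_enorm_sub, ← integral_sub (hgint n) (heint n)]
      refine (enorm_integral_le_lintegral_enorm _).trans ?_
      -- One factor `p_r` stays outside to force convergence to `0`; the other is absorbed in the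
      -- bounded mean of `p_r X_r`.
      calc _ ≤ ∫⁻ ω, ∑ r, ENNReal.ofReal (p n r) * ENNReal.ofReal ((p n r : ℝ) * X n ω r) ∂(μ n) := by
            refine lintegral_mono fun ω => ?_
            simp_rw [← ENNReal.ofReal_mul (p n _).2.1]
            rw [← ENNReal.ofReal_sum_of_nonneg fun r _ => mul_nonneg (p n r).2.1
              (mul_nonneg (p n r).2.1 (Nat.cast_nonneg _)), ← ofReal_norm]
            exact ENNReal.ofReal_le_ofReal
              (abs_prod_one_sub_pow_sub_exp_le (fun r => (p n r).2) ht _)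
        _ = ∑ r, ENNReal.ofReal (p n r) * ∫⁻ ω, ENNReal.ofReal ((p n r : ℝ) * X n ω r) ∂(μ n) := by
            rw [lintegral_finsetSum' _ fun r _ => hcomp fun k =>
              ENNReal.ofReal (p n r) * ENNReal.ofReal ((p n r : ℝ) * k r)]
            exact Finset.sum_congr rfl fun r _ =>
              lintegral_const_mul'' _ (hcomp fun k => ENNReal.ofReal ((p n r : ℝ) * k r))
        _ ≤ _ := Finset.sum_le_sum fun r _ => by gcongr; exact hEn n r
    have hzero : Tendsto (fun n => ∑ r, ENNReal.ofReal (p n r) * C r) atTop (𝓝 0) := by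
      rw [← Finset.sum_const_zero (s := (Finset.univ : Finset (Fin s)))]
      refine tendsto_finsetSum _ fun r _ => ?_
      have h := ENNReal.Tendsto.mul_const (b := C r) (ENNReal.tendsto_ofReal (hp r))
        (Or.inr (hE r).ne)
      simpa using h
    have hedist := tendsto_of_tendsto_of_tendsto_of_le_of_le tendsto_const_nhds hzero
      (fun _ => bot_le) hdist
    refine Tendsto.congr (fun n => (hmap n).symm) ?_
    refine (tendsto_iff_of_dist ?_).1 hgen
    simpa only [dist_edist, ENNReal.toReal_zero, Function.comp_def] using
      (ENNReal.tendsto_toReal ENNReal.zero_ne_top).comp hedist
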